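/- Let $\mathcal V$ be a finite-dimensional real inner product space, $d=\dim\mathcal V$, let $\mathcal T\subseteq\mathcal V$ be convex and $\mathcal R$ a finite set. A property $\Gamma:\mathcal T\rightrightarrows\mathcal R$ assigns to each $t\in\mathcal T$ a nonempty set $\Gamma(t)\subseteq\mathcal R$; its level sets are $\Gamma_r=\{t\in\mathcal T: r\in\Gamma(t)\}$. An affine score (for $\Gamma$) is a family $\mathsf A(r,\cdot)$, $r\in\mathcal R$, of functions $\mathcal V\to\overline{\mathbb R}$ of the form $\ell_1+\infty\cdot\ell_2$ with $\ell_1,\ell_2:\mathcal V\to\mathbb R$ affine (where $\infty\cdot 0=0$), such that $\mathsf A(r,t)<\infty$ for all $t\in\mathcal T$ and $\mathsf A(r,t)\in\mathbb R$ whenever $r\in\Gamma(t)$. It elicits $\Gamma$ if $\Gamma(t)=\operatorname{argmax}_{r\in\mathcal R}\mathsf A(r,t)$ for all $t\in\mathcal T$; $\Gamma$ is elicitable if some affine score elicits it. A cell complex in $\mathcal V$ is a covering of $\mathcal V$ by finitely many nonempty polyhedra (finite intersections of closed halfspaces), called its faces, whose relative interiors are pairwise disjoint and whose nonempty intersections are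 again faces; its cells are its $d$-dimensional faces. It is simple if, for each $j$, each $j$-dimensional face is contained in exactly $d-j+1$ cells. Call $\Gamma$ simple if its level sets are the traces on $\mathcal T$ of the cells of a simple cell complex in $\mathcal V$ all of whose faces meet the interior of $\mathcal T$ (for $\mathcal T=\mathcal V$: if the level sets are the cells of a simple cell complex). **Theorem.** Let $\Gamma:\mathcal T\rightrightarrows\mathcal R$ be an elicitable simple property. If $\Gamma$ has at least three different level sets, assume also that some three different level sets have a common point (that is, the level sets are not just parallel slabs). Then there are points $p_r\in\mathcal V$ ($r\in\mathcal R$) and, for each $\alpha>0$ and $p_0\in\mathcal V$, weights $W(\alpha,p_0)\in\mathbb R^{\mathcal R}$ such that: 1. An affine score $\mathsf A$ elicits $\Gamma$ if and only if there are $\alpha>0$, $p_0\in\mathcal V$ and $w\in\mathbb R^{\mathcal R}$ such that $w-W(\alpha,p_0)$ is constant on $\mathcal R$ and $$\mathsf A(r,t)=2\langle\alpha p_r+p_0,t\rangle-\|\alpha p_r+p_0\|^2+w_r\qquad(r\in\mathcal R,\ t\in\mathcal V).$$ 2. The weights are determined by $\alpha$ and $p_0$ up to a common additive constant: for $\alpha>0$,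 $p_0\in\mathcal V$ and $w\in\mathbb R^{\mathcal R}$, the score $2\langle\alpha p_r+p_0,t\rangle-\|\alpha p_r+p_0\|^2+w_r$ elicits $\Gamma$ if and only if $w-W(\alpha,p_0)$ is constant on $\mathcal R$. 3. The sites are unique up to homothety: for $(q_r)_{r\in\mathcal R}\subseteq\mathcal V$, there is $v\in\mathbb R^{\mathcal R}$ with $\Gamma_r=\{t\in\mathcal T:\ \|q_r-t\|^2-v_r\le\|q_{r'}-t\|^2-v_{r'}\text{ for all }r'\in\mathcal R\}$ for all $r\in\mathcal R$ if and only if there are $\alpha>0$ and $p_0\in\mathcal V$ with $q_r=\alpha p_r+p_0$ for all $r\in\mathcal R$. -/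

import Mathlib

open scoped InnerProductSpace

namespace Elicitation

noncomputable section

variable {V : Type*} [NormedAddCommGroup V] [InnerProductSpace ℝ V] {R : Type*}

/-! ### Properties and affine scores -/

/-- A property `Γ : T ⇉ R`: a multivalued map which associates to each type `t ∈ T` a nonempty
set of correct report values. -/
structure Property (T : Set V) (R : Type*) where
  /-- the set `Γ(t)` of correct reports for the type `t` -/
  correct : T → Set R
  /-- every type has a correct report -/
  nonempty : ∀ t, (correct t).Nonempty

/-- The level set `Γ_r = {t ∈ T | r ∈ Γ(t)}`, as a set of vectors. -/
def Property.levelSet {T : Set V} (Γ : Property T R) (r : R) : Set V :=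
  {t | ∃ h : t ∈ T, r ∈ Γ.correct ⟨t, h⟩}

/-- Affine functions with values in the extended reals: those of the form `ℓ₁ + ∞ · ℓ₂` with
`ℓ₁, ℓ₂` real-valued affine functions, under the convention `∞ · 0 = 0`
(which is the one of `EReal`). -/
def IsExtAffine (f : V → EReal) : Prop :=
  ∃ ℓ₁ ℓ₂ : V →ᵃ[ℝ] ℝ, ∀ t, f t = (ℓ₁ t : EReal) + ⊤ * (ℓ₂ t : EReal)

/-- `A` is a `Γ`-regular affine score with report space `R`: every `A r` is affine
(extended-real-valued), `A r t < ∞` for all types `t`, and `A r t` is finite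
whenever `r` is correct for `t`. -/
structure IsAffineScore {T : Set V} (Γ : Property T R) (A : R → V → EReal) : Prop where
  affine : ∀ r, IsExtAffine (A r)
  lt_top : ∀ r, ∀ t : T, A r t < ⊤
  finite : ∀ t : T, ∀ r ∈ Γ.correct t, A r t ≠ ⊥

/-- `A` elicits `Γ`: for every type `t`, the correct reports are exactly the reports that
maximize `A · t`. -/
def Elicits {T : Set V} (A : R → V → EReal) (Γ : Property T R) : Prop :=
  ∀ t : T, Γ.correct t = {r | ∀ r', A r' t ≤ A r t}

/-- `Γ` is elicitable: some (regular) affine score elicits it. -/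
def Property.Elicitable {T : Set V} (Γ : Property T R) : Prop :=
  ∃ A : R → V → EReal, IsAffineScore Γ A ∧ Elicits A Γ

/-! ### Power diagrams -/

/-- The cell of the site `p r` in the power diagram in `T` with sites `p` and weights `w`. -/
def powerCell (T : Set V) (p : R → V) (w : R → ℝ) (r : R) : Set V :=
  {t | t ∈ T ∧ ∀ r', ‖p r - t‖ ^ 2 - w r ≤ ‖p r' - t‖ ^ 2 - w r'}

/-- The real-valued affine score `2 ⟪p r, t⟫ - ‖p r‖² + w r` with sites `p` and weights `w`. -/
def powerScore (p : R → V) (w : R → ℝ) (r : R) (t : V) : ℝ :=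
  2 * ⟪p r, t⟫_ℝ - ‖p r‖ ^ 2 + w r

/-! ### Cell complexes -/

/-- A polyhedron: the intersection of a finite number of closed halfspaces. -/
def IsPolyhedron (S : Set V) : Prop :=
  ∃ H : Finset (V × ℝ), (∀ h ∈ H, h.1 ≠ 0) ∧ S = {x | ∀ h ∈ H, ⟪h.1, x⟫_ℝ ≤ h.2}

/-- The dimension of (the affine hull of) a nonempty set. -/
def dim (S : Set V) : ℕ := Module.finrank ℝ (vectorSpan ℝ S)

/-- A cell complex in `V`, given as the set of its faces: a covering of `V` by finitely many
nonempty polyhedra whose relative interiors are disjoint and whose nonempty intersections are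
again faces. -/
structure IsCellComplex (C : Set (Set V)) : Prop where
  finite : C.Finite
  nonempty : ∀ F ∈ C, F.Nonempty
  polyhedron : ∀ F ∈ C, IsPolyhedron F
  cover : ⋃₀ C = Set.univ
  disjoint : C.Pairwise fun F G => Disjoint (intrinsicInterior ℝ F) (intrinsicInterior ℝ G)
  inter : ∀ F ∈ C, ∀ G ∈ C, (F ∩ G).Nonempty → F ∩ G ∈ C

/-- The cells of a complex: its faces of dimension `dim V`. -/
def cells (C : Set (Set V)) : Set (Set V) :=
  {Z | Z ∈ C ∧ dim Z = Module.finrank ℝ V}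

/-- A cell complex is simple if each of its `j`-faces is contained in exactly `d - j + 1` cells,
where `d = dim V`.  (Cells are closed; the equation is written without subtraction.) -/
def IsSimpleComplex (C : Set (Set V)) : Prop :=
  IsCellComplex C ∧
    ∀ F ∈ C, {Z | Z ∈ cells C ∧ F ⊆ Z}.ncard + dim F = Module.finrank ℝ V + 1

/-- A property is simple if its level sets form a simple cell complex: they are the traces on `T`
of the cells of a simple cell complex in `V` all of whose faces are met by the interior of `T`.
For `T = V` the level sets are the cells themselves. -/
def Property.IsSimple {T : Set V} (Γ : Property T R) : Prop :=
  ∃ C : Set (Set V), IsSimpleComplex C ∧ (∀ F ∈ C, (F ∩ interior T).Nonempty) ∧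
    ∃ Z : R → Set V, Set.range Z = cells C ∧ ∀ r, Γ.levelSet r = Z r ∩ T

/-- The level sets are not just three or more parallel slabs: if there are at least three
different ones, then some three different ones have a common point. -/
def Property.NotParallel {T : Set V} (Γ : Property T R) : Prop :=
  3 ≤ (Set.range Γ.levelSet).ncard → ∃ t : T, 3 ≤ (Γ.levelSet '' Γ.correct t).ncard

end

end Elicitation

open Elicitation

/-!
The level sets of `Γ` are the cells of a simple complex, traced on `T`, and an eliciting score is a
family of affine functions `⟪g r, ·⟫ + c r` whose pointwise maximum on `T` is attained by `r` exactly
at the points of the cell `Z r`. Completing the square, power scores are just another way to write such families, with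
sites `g r / 2`. The whole theorem therefore reduces to one uniqueness statement
(`Represents.exists_eq_smul_add`): two families with the same cells satisfy `g' r = l • g r + p₀`
and `c' r = l * c r + k` with `l > 0`.

Simplicity says that a point of `interior T` which lies in `n + 1` different cells lies in a face of
codimension `n`. That face contains all nearby points at which the `n + 1` scores agree, so the
gradients of these scores are affinely independent (`Represents.affineIndependent_gradients`). It
follows that, for two cells with a common point, there are points at which only these two
compete, and comparing the two families there gives `g' r - g' s = l • (g r - g s)` with `l > 0`
(`Represents.exists_pos_smul_eq`). For three cells with a common point, the three factors agree, as
two differences of gradients are linearly independent (`Represents.smul_eq_of_triple`).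

It remains to see that all factors agree. Suppose that two cells adjacent to `Z s` have different
factors. The cells adjacent to `Z s` then fall into two classes which do not meet on the boundary of
`Z s`, so this boundary is disconnected. Radial projection onto the boundary shows that a halfspace
cut off by a facet of the first class is disjoint from one cut off by a facet of the second class
(`Represents.disjoint_halfspaces`); hence all facets of `Z s` are parallel and `Z s` is a slab. Being
a slab with a given normal passes on to cells which meet, thus to all cells, and no three different
slabs of the complex meet, contrary to hypothesis (`Represents.smul_eq_of_adjacent`). As the cells
cover a connected space, the common factor at each cell is a common factor for the whole complex.
-/

namespace Elicitation

variable {V : Type*} [NormedAddCommGroup V] [InnerProductSpace ℝ V]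

open scoped Topology

/-! ### Linear functionals and connected sets -/

/-- A nonzero linear functional which is nonnegative exactly where another one is, is a positive
multiple of it. -/
theorem exists_pos_smul_eq_of_inner_nonneg_iff {a b : V} (ha : a ≠ 0)
    (h : ∀ v, 0 ≤ ⟪a, v⟫_ℝ ↔ 0 ≤ ⟪b, v⟫_ℝ) : ∃ l : ℝ, 0 < l ∧ b = l • a := by
  have haa : 0 < ⟪a, a⟫_ℝ := real_inner_self_pos.2 ha
  have hb0 : b ≠ 0 := by
    rintro rfl
    have h1 := (h (-a)).2 (by simp)
    rw [inner_neg_right] at h1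
    linarith
  -- the component of `b` orthogonal to `a`
  set w := b - (⟪a, b⟫_ℝ / ⟪a, a⟫_ℝ) • a with hw
  have hperp : ⟪a, w⟫_ℝ = 0 := by
    rw [hw, inner_sub_right, inner_smul_right]
    field_simp
    ring
  have h1 := (h w).1 hperp.ge
  have h2 := (h (-w)).1 (by rw [inner_neg_right, hperp, neg_zero])
  rw [inner_neg_right] at h2
  have h3 : ⟪b, w⟫_ℝ = 0 := by linarith
  have h4 : ⟪w, w⟫_ℝ = 0 := by
    nth_rewrite 1 [hw]
    rw [inner_sub_left, inner_smul_left, hperp, h3]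
    simp
  have hba : b = (⟪a, b⟫_ℝ / ⟪a, a⟫_ℝ) • a := sub_eq_zero.1 (inner_self_eq_zero.1 h4)
  refine ⟨_, ?_, hba⟩
  have h5 : 0 ≤ ⟪a, b⟫_ℝ := by
    rw [real_inner_comm]
    exact (h a).1 haa.le
  rcases (div_nonneg h5 haa.le).lt_or_eq with h6 | h6
  · exact h6
  · rw [← h6, zero_smul] at hba
    exact absurd hba hb0

theorem exists_smul_eq_of_inner_eq_zero {a b : V} (h : ∀ v, ⟪a, v⟫_ℝ = 0 → ⟪b, v⟫_ℝ = 0) :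
    ∃ k : ℝ, b = k • a := by
  have hb : b ∈ (ℝ ∙ a)ᗮᗮ := by
    intro v hv
    rw [real_inner_comm]
    exact h v (hv a (Submodule.mem_span_singleton_self a))
  rw [Submodule.orthogonal_orthogonal] at hb
  obtain ⟨k, hk⟩ := Submodule.mem_span_singleton.1 hb
  exact ⟨k, hk.symm⟩

/-- If two closed halfspaces are disjoint, then their normals are parallel. -/
theorem inner_eq_zero_of_disjoint_halfspaces {a b : V} {α β : ℝ} (ha : a ≠ 0) (hb : b ≠ 0)
    (h : ∀ z, 0 ≤ ⟪a, z⟫_ℝ + α → ¬ 0 ≤ ⟪b, z⟫_ℝ + β) {v : V} :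
    ⟪a, v⟫_ℝ = 0 ↔ ⟪b, v⟫_ℝ = 0 := by
  have ha' := norm_pos_iff.2 ha
  have hb' := norm_pos_iff.2 hb
  have hab : ⟪a, b⟫_ℝ = -(‖a‖ * ‖b‖) := by
    by_contra hne
    have hlt : 0 < ‖a‖ * ‖b‖ + ⟪a, b⟫_ℝ := by
      have h1 := (abs_le.1 (abs_real_inner_le_norm a b)).1
      rcases h1.lt_or_eq with h2 | h2
      · linarith
      · exact absurd h2.symm hne
    -- otherwise both functionals are positive on the bisector of `a` and `b`
    set w := ‖b‖ • a + ‖a‖ • b with hw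
    have haw : 0 < ⟪a, w⟫_ℝ := by
      have : ⟪a, w⟫_ℝ = ‖a‖ * (‖a‖ * ‖b‖ + ⟪a, b⟫_ℝ) := by
        rw [hw, inner_add_right, inner_smul_right, inner_smul_right, real_inner_self_eq_norm_sq]
        ring
      rw [this]
      positivity
    have hbw : 0 < ⟪b, w⟫_ℝ := by
      have : ⟪b, w⟫_ℝ = ‖b‖ * (‖a‖ * ‖b‖ + ⟪a, b⟫_ℝ) := by
        rw [hw, inner_add_right, inner_smul_right, inner_smul_right, real_inner_self_eq_norm_sq,
          real_inner_comm a b]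
        ring
      rw [this]
      positivity
    set k := max (-α / ⟪a, w⟫_ℝ) (-β / ⟪b, w⟫_ℝ)
    refine h (k • w) ?_ ?_
    · have := (div_le_iff₀ haw).1 (le_max_left (-α / ⟪a, w⟫_ℝ) (-β / ⟪b, w⟫_ℝ))
      rw [inner_smul_right]
      linarith
    · have := (div_le_iff₀ hbw).1 (le_max_right (-α / ⟪a, w⟫_ℝ) (-β / ⟪b, w⟫_ℝ))
      rw [inner_smul_right]
      linarith
  have hzero : ‖b‖ • a + ‖a‖ • b = 0 := by
    rw [← inner_self_eq_zero (𝕜 := ℝ)]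
    simp only [inner_add_left, inner_add_right, inner_smul_left, inner_smul_right,
      real_inner_self_eq_norm_sq, real_inner_comm a b, hab, RCLike.conj_to_real]
    ring
  have hv : ‖b‖ * ⟪a, v⟫_ℝ + ‖a‖ * ⟪b, v⟫_ℝ = 0 := by
    rw [← real_inner_smul_left, ← real_inner_smul_left, ← inner_add_left, hzero, inner_zero_left]
  constructor
  · intro h0
    rw [h0, mul_zero, zero_add] at hv
    exact (mul_eq_zero.1 hv).resolve_left ha'.ne'
  · intro h0
    rw [h0, mul_zero, add_zero] at hv
    exact (mul_eq_zero.1 hv).resolve_left hb'.ne'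

/-- The inner products of a vector with a linearly independent family can be prescribed. -/
theorem exists_inner_eq_of_linearIndependent [FiniteDimensional ℝ V] {ι : Type*} {v : ι → V}
    (hv : LinearIndependent ℝ v) (f : ι → ℝ) : ∃ w : V, ∀ i, ⟪v i, w⟫_ℝ = f i := by
  obtain ⟨φ, hφ⟩ := LinearMap.exists_extend
    ((Finsupp.linearCombination ℝ f).comp hv.repr)
  refine ⟨(InnerProductSpace.toDual ℝ V).symm (LinearMap.toContinuousLinearMap φ), fun i => ?_⟩
  rw [real_inner_comm, InnerProductSpace.toDual_symm_apply]
  have hi : v i ∈ Submodule.span ℝ (Set.range v) := Submodule.subset_span ⟨i, rfl⟩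
  have h1 := LinearMap.congr_fun hφ ⟨v i, hi⟩
  have h2 : hv.repr ⟨v i, hi⟩ = Finsupp.single i 1 := hv.repr_eq_single i _ rfl
  simpa [h2] using h1

/-- A neighbourhood of a point contains a segment in each direction. -/
theorem exists_pos_forall_add_smul_mem {O : Set V} {x : V} (hO : O ∈ 𝓝 x) (v : V) :
    ∃ ε : ℝ, 0 < ε ∧ ∀ τ : ℝ, |τ| ≤ ε → x + τ • v ∈ O := by
  have hc : Filter.Tendsto (fun τ : ℝ => x + τ • v) (𝓝 0) (𝓝 x) := by
    have : Continuous fun τ : ℝ => x + τ • v := by fun_prop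
    simpa using this.tendsto 0
  obtain ⟨ε, hε, h⟩ := Metric.mem_nhds_iff.1 (hc hO)
  refine ⟨ε / 2, by positivity, fun τ hτ => h ?_⟩
  rw [Metric.mem_ball, dist_zero_right, Real.norm_eq_abs]
  linarith

/-- If a connected set is covered by finitely many closed sets, which fall into two classes both
of which meet it, then a member of one class meets a member of the other one. -/
theorem exists_mem_inter_of_isPreconnected {X ι : Type*} [TopologicalSpace X] [Finite ι]
    {S : Set X} (hS : IsPreconnected S) {D : ι → Set X} (hD : ∀ i, IsClosed (D i))
    (hcov : ∀ x ∈ S, ∃ i, x ∈ D i) (P : ι → Prop)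
    (h1 : ∃ x ∈ S, ∃ i, P i ∧ x ∈ D i) (h2 : ∃ x ∈ S, ∃ i, ¬ P i ∧ x ∈ D i) :
    ∃ x ∈ S, ∃ i j, P i ∧ ¬ P j ∧ x ∈ D i ∧ x ∈ D j := by
  have key := isPreconnected_closed_iff.1 hS (⋃ i ∈ {i | P i}, D i) (⋃ i ∈ {i | ¬ P i}, D i)
    ((Set.toFinite _).isClosed_biUnion fun i _ => hD i)
    ((Set.toFinite _).isClosed_biUnion fun i _ => hD i)
  simp only [Set.subset_def, Set.Nonempty, Set.mem_inter_iff, Set.mem_union, Set.mem_iUnion,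
    Set.mem_ofPred_eq, exists_prop] at key
  obtain ⟨x, hx, ⟨i, hi, hxi⟩, j, hj, hxj⟩ := key (fun x hx => by
      obtain ⟨i, hi⟩ := hcov x hx
      by_cases hP : P i
      exacts [Or.inl ⟨i, hP, hi⟩, Or.inr ⟨i, hP, hi⟩]) h1 h2
  exact ⟨x, hx, i, j, hi, hj, hxi, hxj⟩

variable {R : Type*} {T : Set V} {Z : R → Set V} {g g' : R → V} {c c' : R → ℝ}

/-! ### Cell systems and their scores -/

/-- The cells of a simple cell complex whose faces meet the interior of `T`, indexed by `R`, where a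
cell may occur repeatedly. Only what matters for the uniqueness of scores is recorded; in
particular, simplicity is recorded only for the smallest face through a point of `interior T`, the
intersection of the cells which contain the point. -/
structure IsCellSystem (T : Set V) (Z : R → Set V) : Prop where
  convex : ∀ r, Convex ℝ (Z r)
  isClosed : ∀ r, IsClosed (Z r)
  interior_nonempty : ∀ r, (interior (Z r) ∩ interior T).Nonempty
  cover : ∀ x, ∃ r, x ∈ Z r
  disjoint : ∀ r s, Z r ≠ Z s → Disjoint (interior (Z r)) (interior (Z s))
  meets : ∀ r s u, (Z r ∩ Z s ∩ Z u).Nonempty → (Z r ∩ Z s ∩ Z u ∩ interior T).Nonempty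
  card_add_dim : ∀ t ∈ interior T,
    (Z '' {r | t ∈ Z r}).ncard + dim (⋂ r ∈ {r | t ∈ Z r}, Z r) = Module.finrank ℝ V + 1

/-- The real-valued affine score with gradients `g r` and constant terms `c r`. -/
def affScore (g : R → V) (c : R → ℝ) (r : R) (t : V) : ℝ := ⟪g r, t⟫_ℝ + c r

/-- On `T`, the cell `Z r` consists of the points at which the score of `r` is maximal. -/
def Represents (T : Set V) (Z : R → Set V) (g : R → V) (c : R → ℝ) : Prop :=
  ∀ t ∈ T, ∀ r, t ∈ Z r ↔ ∀ r', affScore g c r' t ≤ affScore g c r t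

theorem affScore_add_smul (r : R) (t v : V) (τ : ℝ) :
    affScore g c r (t + τ • v) = affScore g c r t + τ * ⟪g r, v⟫_ℝ := by
  rw [affScore, affScore, inner_add_right, inner_smul_right]
  ring

namespace IsCellSystem

theorem mem_closure_interior (hZ : IsCellSystem T Z) {r : R} {x : V} (hx : x ∈ Z r) :
    x ∈ closure (interior (Z r)) := by
  rw [(hZ.convex r).closure_interior_eq_closure_of_nonempty_interior
    ((hZ.interior_nonempty r).mono Set.inter_subset_left)]
  exact subset_closure hx

theorem eventually_mem [Finite R] (hZ : IsCellSystem T Z) (x : V) :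
    ∀ᶠ y in 𝓝 x, ∀ u, y ∈ Z u → x ∈ Z u := by
  rw [Filter.eventually_all]
  intro u
  by_cases hx : x ∈ Z u
  · exact Filter.Eventually.of_forall fun _ _ => hx
  · filter_upwards [(hZ.isClosed u).isOpen_compl.mem_nhds hx] with y hy hyu
    exact absurd hyu hy

theorem exists_ne_of_notMem_interior [Finite R] (hZ : IsCellSystem T Z) {s : R} {x : V}
    (hx : x ∉ interior (Z s)) : ∃ r, Z r ≠ Z s ∧ x ∈ Z r := by
  by_contra! h
  refine hx (mem_interior_iff_mem_nhds.2 ?_)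
  filter_upwards [hZ.eventually_mem x] with y hy
  obtain ⟨u, hu⟩ := hZ.cover y
  by_contra hys
  exact h u (fun hus => hys (hus ▸ hu)) (hy u hu)

theorem meets₂ (hZ : IsCellSystem T Z) {r s : R} (h : (Z r ∩ Z s).Nonempty) :
    ∃ t ∈ interior T, t ∈ Z r ∧ t ∈ Z s := by
  obtain ⟨x, hxr, hxs⟩ := h
  obtain ⟨t, ⟨⟨htr, hts⟩, -⟩, ht⟩ := hZ.meets r s s ⟨x, ⟨hxr, hxs⟩, hxs⟩
  exact ⟨t, ht, htr, hts⟩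

end IsCellSystem

namespace Represents

theorem eq_of_mem (hg : Represents T Z g c) {r s : R} {t : V} (ht : t ∈ T) (hr : t ∈ Z r)
    (hs : t ∈ Z s) : affScore g c r t = affScore g c s t :=
  le_antisymm ((hg t ht s).1 hs r) ((hg t ht r).1 hr s)

/-- The cell determines the score. -/
theorem eq_of_cell_eq (hg : Represents T Z g c) (hZ : IsCellSystem T Z) {r s : R}
    (h : Z r = Z s) : g r = g s ∧ c r = c s := by
  obtain ⟨x, hxZ, hxT⟩ := hZ.interior_nonempty r
  have key : ∀ y ∈ Z r ∩ T, affScore g c r y = affScore g c s y :=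
    fun y hy => hg.eq_of_mem hy.2 hy.1 (h ▸ hy.1)
  have hx := key x ⟨interior_subset hxZ, interior_subset hxT⟩
  have hgg : g r = g s := by
    refine ext_inner_right ℝ fun v => ?_
    obtain ⟨ε, hε, hmem⟩ := exists_pos_forall_add_smul_mem
      (Filter.inter_mem (mem_interior_iff_mem_nhds.1 hxZ) (mem_interior_iff_mem_nhds.1 hxT)) v
    have h1 := key _ (hmem ε (abs_of_pos hε).le)
    rw [affScore_add_smul, affScore_add_smul, hx] at h1
    exact mul_left_cancel₀ hε.ne' (add_left_cancel h1)
  refine ⟨hgg, ?_⟩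
  simpa [affScore, hgg] using hx

theorem cell_eq_of_eq (hg : Represents T Z g c) (hZ : IsCellSystem T Z) {r s : R}
    (h1 : g r = g s) (h2 : c r = c s) : Z r = Z s := by
  by_contra hne
  obtain ⟨x, hxr, hxT⟩ := hZ.interior_nonempty r
  refine Set.disjoint_left.1 (hZ.disjoint r s hne) hxr (mem_interior_iff_mem_nhds.2 ?_)
  filter_upwards [mem_interior_iff_mem_nhds.1 hxr, mem_interior_iff_mem_nhds.1 hxT] with y hy hyT
  refine (hg y hyT s).2 fun u => ?_
  have h3 := (hg y hyT r).1 hy u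
  have h4 : affScore g c s y = affScore g c r y := by rw [affScore, affScore, h1, h2]
  exact h4 ▸ h3

theorem cell_eq_of_gradient_eq (hg : Represents T Z g c) (hZ : IsCellSystem T Z) {r s : R} {t : V}
    (ht : t ∈ T) (hr : t ∈ Z r) (hs : t ∈ Z s) (h : g r = g s) : Z r = Z s := by
  refine hg.cell_eq_of_eq hZ h ?_
  simpa [affScore, h] using hg.eq_of_mem ht hr hs

/-- Where two cells meet, the inequality between their scores which holds on `T` extends to all of
the cell. -/
theorem le_of_meets (hg : Represents T Z g c) (hZ : IsCellSystem T Z) {r s : R}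
    (h : (Z r ∩ Z s).Nonempty) {x : V} (hx : x ∈ Z s) : affScore g c r x ≤ affScore g c s x := by
  obtain ⟨t, htT, htr, hts⟩ := hZ.meets₂ h
  obtain ⟨ε, hε, hmem⟩ := exists_pos_forall_add_smul_mem
    (mem_interior_iff_mem_nhds.1 htT) (x - t)
  -- near `t`, the segment from `t` to `x` lies in `T`, and the two scores agree at `t`
  set δ := min ε 1 with hδ
  have hδ0 : 0 < δ := lt_min hε one_pos
  have hT := hmem δ (by rw [abs_of_pos hδ0]; exact min_le_left _ _)
  have hs : t + δ • (x - t) ∈ Z s :=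
    (hZ.convex s).add_smul_sub_mem hts hx ⟨hδ0.le, min_le_right _ _⟩
  have h1 := (hg _ hT s).1 hs r
  have h0 := hg.eq_of_mem (interior_subset htT) htr hts
  rw [affScore_add_smul, affScore_add_smul, h0] at h1
  have h2 : ⟪g r, x - t⟫_ℝ ≤ ⟪g s, x - t⟫_ℝ := le_of_mul_le_mul_left (by linarith) hδ0
  have h3 := affScore_add_smul (g := g) (c := c) r t (x - t) 1
  have h4 := affScore_add_smul (g := g) (c := c) s t (x - t) 1
  rw [one_smul, add_sub_cancel] at h3 h4
  linarith

theorem lt_of_meets (hg : Represents T Z g c) (hZ : IsCellSystem T Z) {r s : R}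
    (hne : Z r ≠ Z s) (h : (Z r ∩ Z s).Nonempty) {x : V} (hx : x ∈ interior (Z s)) :
    affScore g c r x < affScore g c s x := by
  refine lt_of_le_of_ne (hg.le_of_meets hZ h (interior_subset hx)) fun heq => ?_
  have hgg : g r = g s := by
    refine ext_inner_right ℝ fun v => ?_
    obtain ⟨ε, hε, hmem⟩ := exists_pos_forall_add_smul_mem (mem_interior_iff_mem_nhds.1 hx) v
    have h1 := hg.le_of_meets hZ h (hmem ε (abs_of_pos hε).le)
    have h2 := hg.le_of_meets hZ h (hmem (-ε) (by rw [abs_neg, abs_of_pos hε]))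
    rw [affScore_add_smul, affScore_add_smul, heq] at h1 h2
    exact mul_left_cancel₀ hε.ne' (by linarith)
  exact hne (hg.cell_eq_of_eq hZ hgg (by simpa [affScore, hgg] using heq))

theorem eq_of_mem_inter (hg : Represents T Z g c) (hZ : IsCellSystem T Z) {r s : R} {x : V}
    (hr : x ∈ Z r) (hs : x ∈ Z s) : affScore g c r x = affScore g c s x :=
  le_antisymm (hg.le_of_meets hZ ⟨x, hr, hs⟩ hs) (hg.le_of_meets hZ ⟨x, hs, hr⟩ hr)

/-! ### Affine independence of the gradients at a point -/

/-- Simplicity makes the gradients of the maximal scores at a point affinely independent: the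
smallest face through the point contains all nearby points at which these scores agree, so its
dimension is at least the codimension of the span of the differences of gradients. -/
theorem affineIndependent_gradients [FiniteDimensional ℝ V] [Finite R]
    (hg : Represents T Z g c) (hZ : IsCellSystem T Z) {t : V} (ht : t ∈ interior T) :
    AffineIndependent ℝ (Subtype.val : (g '' {r | t ∈ Z r}) → V) := by
  classical
  set N : Set R := {r | t ∈ Z r} with hN
  set G : Set V := ⋂ r ∈ N, Z r with hG
  have htT := interior_subset ht
  have hcard : (Z '' N).ncard + dim G = Module.finrank ℝ V + 1 := hZ.card_add_dim t ht
  obtain ⟨r₀, hr₀⟩ := hZ.cover t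
  have : Nonempty R := ⟨r₀⟩
  -- a cell through `t` is determined by its gradient, since the scores agree at `t`
  have hcc : (Z '' N).ncard = (g '' N).ncard := by
    have hmaps : ∀ r ∈ N, ∀ s ∈ N, g r = g s → Z r = Z s := fun r hr s hs =>
      hg.cell_eq_of_gradient_eq hZ htT hr hs
    choose! f hf using fun (X : Set V) (hX : X ∈ Z '' N) => hX
    refine Set.ncard_congr (fun X _ => g (f X)) (fun X hX => ⟨_, (hf X hX).1, rfl⟩) ?_ ?_
    · intro X Y hX hY hXY
      rw [← (hf X hX).2, ← (hf Y hY).2]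
      exact hmaps _ (hf X hX).1 _ (hf Y hY).1 hXY
    · rintro _ ⟨r, hr, rfl⟩
      exact ⟨Z r, ⟨r, hr, rfl⟩, (hg.eq_of_cell_eq hZ (hf (Z r) ⟨r, hr, rfl⟩).2).1⟩
  -- a direction orthogonal to all differences of gradients does not leave the face
  have hsub : (vectorSpan ℝ (g '' N))ᗮ ≤ vectorSpan ℝ G := by
    intro v hv
    obtain ⟨ε, hε, hmem⟩ := exists_pos_forall_add_smul_mem
      (Filter.inter_mem (hZ.eventually_mem t) (mem_interior_iff_mem_nhds.1 ht)) v
    obtain ⟨hm1, hm2⟩ := hmem ε (abs_of_pos hε).le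
    have htG : t ∈ G := Set.mem_iInter₂.2 fun r hr => hr
    have hvG : t + ε • v ∈ G := by
      refine Set.mem_iInter₂.2 fun r hr => ?_
      obtain ⟨u, hu⟩ := hZ.cover (t + ε • v)
      have hut : t ∈ Z u := hm1 u hu
      have h0 : ⟪g r - g u, v⟫_ℝ = 0 :=
        hv _ (vsub_mem_vectorSpan ℝ ⟨r, hr, rfl⟩ ⟨u, hut, rfl⟩)
      rw [inner_sub_left, sub_eq_zero] at h0
      refine (hg _ hm2 r).2 fun r' => ?_
      have h1 := (hg _ hm2 u).1 hu r'
      rwa [affScore_add_smul u, ← h0, ← hg.eq_of_mem htT hr hut, ← affScore_add_smul r] at h1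
    have h2 := vsub_mem_vectorSpan ℝ hvG htG
    rw [vsub_eq_sub, add_sub_cancel_left] at h2
    exact (Submodule.smul_mem_iff _ hε.ne').1 h2
  have hdim : Module.finrank ℝ (vectorSpan ℝ (g '' N))ᗮ ≤ dim G :=
    Submodule.finrank_mono hsub
  have hsum := Submodule.finrank_add_finrank_orthogonal (vectorSpan ℝ (g '' N))
  have hfin : (g '' N).Finite := Set.toFinite _
  have hpos : 0 < (g '' N).ncard := (Set.ncard_pos hfin).2 ⟨g r₀, r₀, hr₀, rfl⟩
  have : Fintype (g '' N) := hfin.fintype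
  obtain ⟨n, hn⟩ : ∃ n, (g '' N).ncard = n + 1 := ⟨(g '' N).ncard - 1, by omega⟩
  rw [affineIndependent_iff_le_finrank_vectorSpan ℝ (n := n) _
    (by rw [← Nat.card_eq_fintype_card, Nat.card_coe_set_eq, hn]), Subtype.range_coe]
  omega

/-- The gradients of the maximal scores at a point take prescribed values, up to a common
constant, in some direction. -/
theorem exists_inner_gradient_sub_eq [FiniteDimensional ℝ V] [Finite R]
    (hg : Represents T Z g c) (hZ : IsCellSystem T Z) {t : V} (ht : t ∈ interior T)
    {s : R} (hs : t ∈ Z s) (f : V → ℝ) :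
    ∃ w, ∀ u, t ∈ Z u → ⟪g u - g s, w⟫_ℝ = f (g u) - f (g s) := by
  have h := hg.affineIndependent_gradients hZ ht
  rw [affineIndependent_iff_linearIndependent_vsub ℝ _ ⟨g s, s, hs, rfl⟩] at h
  obtain ⟨w, hw⟩ := exists_inner_eq_of_linearIndependent h fun i => f i.1 - f (g s)
  refine ⟨w, fun u hu => ?_⟩
  by_cases hus : g u = g s
  · simp [hus]
  · exact hw ⟨⟨g u, u, hu, rfl⟩, fun h => hus (congrArg Subtype.val h)⟩

/-- Three different cells with a common point in `interior T` have gradients in general position. -/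
theorem eq_zero_of_smul_add_smul [FiniteDimensional ℝ V] [Finite R]
    (hg : Represents T Z g c) (hZ : IsCellSystem T Z) {t : V} (ht : t ∈ interior T) {r s u : R}
    (hr : t ∈ Z r) (hs : t ∈ Z s) (hu : t ∈ Z u) (hrs : Z r ≠ Z s) (hru : Z r ≠ Z u)
    {a b : ℝ} (h : a • (g r - g s) + b • (g u - g s) = 0) : a = 0 := by
  classical
  obtain ⟨w, hw⟩ := hg.exists_inner_gradient_sub_eq hZ ht hs fun x => if x = g r then 1 else 0
  have hgs : g s ≠ g r := fun h =>
    hrs (hg.cell_eq_of_gradient_eq hZ (interior_subset ht) hr hs h.symm)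
  have hgu : g u ≠ g r := fun h =>
    hru (hg.cell_eq_of_gradient_eq hZ (interior_subset ht) hr hu h.symm)
  have h1 := congrArg (fun x => ⟪x, w⟫_ℝ) h
  simpa [inner_add_left, real_inner_smul_left, hw r hr, hw u hu, hgs, hgu] using h1

/-! ### Comparison of two scores at a common point of two cells -/

/-- If two scores have the same cells, then the differences of the scores of two cells which meet
are proportional. Both scores are compared near a point of `T` at which only these two cells
compete; there is one by the affine independence of the gradients. -/
theorem exists_pos_smul_eq [FiniteDimensional ℝ V] [Finite R]
    (hg : Represents T Z g c) (hg' : Represents T Z g' c') (hZ : IsCellSystem T Z) {r s : R}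
    (hne : Z r ≠ Z s) (h : (Z r ∩ Z s).Nonempty) :
    ∃ l : ℝ, 0 < l ∧ g' r - g' s = l • (g r - g s) := by
  classical
  obtain ⟨t, htT, htr, hts⟩ := hZ.meets₂ h
  have hgne : g r ≠ g s := fun h =>
    hne (hg.cell_eq_of_gradient_eq hZ (interior_subset htT) htr hts h)
  obtain ⟨w, hw⟩ := hg.exists_inner_gradient_sub_eq hZ htT hts
    fun x => if x = g r ∨ x = g s then 0 else -1
  obtain ⟨ε, hε, hmem⟩ := exists_pos_forall_add_smul_mem
    (Filter.inter_mem (hZ.eventually_mem t) (isOpen_interior.mem_nhds htT)) w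
  set x := t + ε • w with hx
  obtain ⟨hx1, hxT⟩ := hmem ε (abs_of_pos hε).le
  have hrw : ⟪g r, w⟫_ℝ = ⟪g s, w⟫_ℝ := by
    have := hw r htr
    simp only [true_or, or_true, if_true, inner_sub_left] at this
    linarith
  -- at `x`, no other cell competes with `Z r` and `Z s`
  have honly : ∀ u, x ∈ Z u → Z u = Z r ∨ Z u = Z s := by
    intro u hu
    by_contra! hcon
    have htu := hx1 u hu
    have h1 : ¬ (g u = g r ∨ g u = g s) := by
      rintro (h | h)
      · exact hcon.1 (hg.cell_eq_of_gradient_eq hZ (interior_subset htT) htu htr h)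
      · exact hcon.2 (hg.cell_eq_of_gradient_eq hZ (interior_subset htT) htu hts h)
    have h2 := hw u htu
    simp only [h1, or_true, if_true, if_false, inner_sub_left] at h2
    have h3 := (hg x (interior_subset hxT) u).1 hu s
    rw [hx, affScore_add_smul, affScore_add_smul,
      hg.eq_of_mem (interior_subset htT) hts htu] at h3
    nlinarith
  have hboth : x ∈ Z r ∧ x ∈ Z s := by
    have heq : affScore g c r x = affScore g c s x := by
      rw [hx, affScore_add_smul, affScore_add_smul, hrw,
        hg.eq_of_mem (interior_subset htT) htr hts]
    obtain ⟨u, hu⟩ := hZ.cover x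
    rcases honly u hu with h | h
    · refine ⟨h ▸ hu, (hg x (interior_subset hxT) s).2 fun r' => heq ▸ ?_⟩
      exact (hg x (interior_subset hxT) r).1 (h ▸ hu) r'
    · refine ⟨(hg x (interior_subset hxT) r).2 fun r' => heq ▸ ?_, h ▸ hu⟩
      exact (hg x (interior_subset hxT) s).1 (h ▸ hu) r'
  -- hence a direction leads into `Z r` if and only if the score of `r` grows faster
  have hdir : ∀ (k : R → V) (d : R → ℝ), Represents T Z k d → ∀ v : V, ∃ ε₀ : ℝ, 0 < ε₀ ∧
      ∀ τ : ℝ, 0 < τ → τ ≤ ε₀ → (x + τ • v ∈ Z r ↔ 0 ≤ ⟪k r - k s, v⟫_ℝ) := by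
    intro k d hk v
    obtain ⟨δ, hδ, hm⟩ := exists_pos_forall_add_smul_mem
      (Filter.inter_mem (hZ.eventually_mem x) (mem_interior_iff_mem_nhds.1 hxT)) v
    refine ⟨δ, hδ, fun τ hτ hτδ => ?_⟩
    obtain ⟨hy1, hyT⟩ := hm τ (by rwa [abs_of_pos hτ])
    have heq := hk.eq_of_mem (interior_subset hxT) hboth.1 hboth.2
    have hiff : x + τ • v ∈ Z r ↔ affScore k d s (x + τ • v) ≤ affScore k d r (x + τ • v) := by
      refine ⟨fun h => (hk _ hyT r).1 h s, fun h => ?_⟩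
      obtain ⟨u, hu⟩ := hZ.cover (x + τ • v)
      rcases honly u (hy1 u hu) with h' | h'
      · exact h' ▸ hu
      · exact (hk _ hyT r).2 fun r' => ((hk _ hyT s).1 (h' ▸ hu) r').trans h
    rw [hiff, affScore_add_smul s x, affScore_add_smul r x, heq, inner_sub_left, sub_nonneg,
      add_le_add_iff_left, mul_le_mul_iff_right₀ hτ]
  refine exists_pos_smul_eq_of_inner_nonneg_iff (sub_ne_zero.2 hgne) fun v => ?_
  obtain ⟨δ, hδ, h1⟩ := hdir g c hg v
  obtain ⟨δ', hδ', h2⟩ := hdir g' c' hg' v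
  rw [← h1 (min δ δ') (lt_min hδ hδ') (min_le_left _ _),
    ← h2 (min δ δ') (lt_min hδ hδ') (min_le_right _ _)]

/-- Three different cells with a common point have a common factor of proportionality. -/
theorem smul_eq_of_triple [FiniteDimensional ℝ V] [Finite R]
    (hg : Represents T Z g c) (hg' : Represents T Z g' c') (hZ : IsCellSystem T Z) {r s u : R}
    (hrs : Z r ≠ Z s) (hus : Z u ≠ Z s) (h : (Z r ∩ Z s ∩ Z u).Nonempty) {l : ℝ}
    (hl : g' r - g' s = l • (g r - g s)) : g' u - g' s = l • (g u - g s) := by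
  by_cases hru : Z r = Z u
  · rwa [← (hg.eq_of_cell_eq hZ hru).1, ← (hg'.eq_of_cell_eq hZ hru).1]
  obtain ⟨t, ⟨⟨htr, hts⟩, htu⟩, ht⟩ := hZ.meets r s u h
  obtain ⟨m, -, hm⟩ := hg.exists_pos_smul_eq hg' hZ hus ⟨t, htu, hts⟩
  obtain ⟨n, -, hn⟩ := hg.exists_pos_smul_eq hg' hZ hru ⟨t, htr, htu⟩
  have h1 : (n - l) • (g r - g s) + (m - n) • (g u - g s) = 0 := by
    have h2 : n • (g r - g u) = l • (g r - g s) - m • (g u - g s) := by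
      rw [← hl, ← hm, ← hn]
      abel
    have h3 : n • (g r - g u) = n • (g r - g s) - n • (g u - g s) := by
      rw [← smul_sub]
      congr 1
      abel
    rw [sub_smul, sub_smul]
    rw [h3] at h2
    rw [← sub_eq_zero.2 h2]
    abel
  have h4 := hg.eq_zero_of_smul_add_smul hZ ht htr hts htu hrs hru h1
  have h5 := hg.eq_zero_of_smul_add_smul hZ ht htu hts htr hus (Ne.symm hru)
    ((add_comm _ _).trans h1)
  rw [hm, show m = l by linarith]

end Represents

/-! ### Parallel slabs -/

/-- The set `S` is a union of hyperplanes orthogonal to `a` (for `a ≠ 0` and a nonempty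
closed convex set: a slab, a halfspace, a hyperplane, or everything). -/
def IsSlab (a : V) (S : Set V) : Prop := ∀ x ∈ S, ∀ v, ⟪a, v⟫_ℝ = 0 → x + v ∈ S

theorem isSlab_of_hyperplane_subset {a t : V} {S : Set V} (hconv : Convex ℝ S)
    (hclosed : IsClosed S) (h : ∀ v, ⟪a, v⟫_ℝ = 0 → t + v ∈ S) : IsSlab a S := by
  intro x hx v hv
  -- `x + v` is the limit of the points of the segments from `x` to far points of the hyperplane
  have hlim : Filter.Tendsto (fun τ : ℝ => x + v + τ • (t - x)) (𝓝[>] 0) (𝓝 (x + v)) := by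
    have : Continuous fun τ : ℝ => x + v + τ • (t - x) := by fun_prop
    simpa using (this.tendsto 0).mono_left nhdsWithin_le_nhds
  refine hclosed.mem_of_tendsto hlim ?_
  filter_upwards [Ioo_mem_nhdsGT (zero_lt_one' ℝ)] with τ hτ
  have h1 := h (τ⁻¹ • v) (by rw [inner_smul_right, hv, mul_zero])
  have h2 := hconv.add_smul_sub_mem hx h1 ⟨hτ.1.le, hτ.2.le⟩
  have h3 : x + τ • (t + τ⁻¹ • v - x) = x + v + τ • (t - x) := by
    rw [add_sub_right_comm, smul_add, smul_smul, mul_inv_cancel₀ hτ.1.ne', one_smul]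
    abel
  rwa [h3] at h2

/-- Cells can be connected to each other through cells which meet. -/
theorem IsCellSystem.induction_on_meets [Finite R] (hZ : IsCellSystem T Z) {P : R → Prop} {s : R}
    (hs : P s) (hP : ∀ r u, (Z r ∩ Z u).Nonempty → P r → P u) (u : R) : P u := by
  by_contra hu
  obtain ⟨xs, hxs, -⟩ := hZ.interior_nonempty s
  obtain ⟨xu, hxu, -⟩ := hZ.interior_nonempty u
  obtain ⟨y, -, i, j, hi, hj, hyi, hyj⟩ := exists_mem_inter_of_isPreconnected
    (convex_univ (𝕜 := ℝ) (E := V)).isPreconnected hZ.isClosed (fun x _ => hZ.cover x) P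
    ⟨xs, trivial, s, hs, interior_subset hxs⟩ ⟨xu, trivial, u, hu, interior_subset hxu⟩
  exact hj (hP i j ⟨y, hyi, hyj⟩ hi)

namespace Represents

theorem inner_gradient_sub_eq_zero (hg : Represents T Z g c) (hZ : IsCellSystem T Z) {r s : R}
    {a : V} (hs : IsSlab a (Z s)) (h : (Z r ∩ Z s).Nonempty) {v : V} (hv : ⟪a, v⟫_ℝ = 0) :
    ⟪g r - g s, v⟫_ℝ = 0 := by
  obtain ⟨t, htr, hts⟩ := h
  have h0 := hg.eq_of_mem_inter hZ htr hts
  have h1 := hg.le_of_meets hZ ⟨t, htr, hts⟩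
    (hs t hts ((1 : ℝ) • v) (by rw [inner_smul_right, hv, mul_zero]))
  have h2 := hg.le_of_meets hZ ⟨t, htr, hts⟩
    (hs t hts ((-1 : ℝ) • v) (by rw [inner_smul_right, hv, mul_zero]))
  rw [affScore_add_smul, affScore_add_smul, h0] at h1 h2
  rw [inner_sub_left]
  linarith

/-- Cells which are slabs are not involved in triple intersections. -/
theorem not_nonempty_triple_of_isSlab [FiniteDimensional ℝ V] [Finite R]
    (hg : Represents T Z g c) (hZ : IsCellSystem T Z) {r s u : R} {a : V} (hs : IsSlab a (Z s))
    (hrs : Z r ≠ Z s) (hus : Z u ≠ Z s) (hru : Z r ≠ Z u) : ¬ (Z r ∩ Z s ∩ Z u).Nonempty := by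
  intro h
  obtain ⟨t, ⟨⟨htr, hts⟩, htu⟩, ht⟩ := hZ.meets r s u h
  obtain ⟨k, hk⟩ := exists_smul_eq_of_inner_eq_zero fun v (hv : ⟪a, v⟫_ℝ = 0) =>
    hg.inner_gradient_sub_eq_zero hZ hs ⟨t, htr, hts⟩ hv
  obtain ⟨m, hm⟩ := exists_smul_eq_of_inner_eq_zero fun v (hv : ⟪a, v⟫_ℝ = 0) =>
    hg.inner_gradient_sub_eq_zero hZ hs ⟨t, htu, hts⟩ hv
  have h1 : m • (g r - g s) + (-k) • (g u - g s) = 0 := by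
    rw [hk, hm, smul_smul, smul_smul, ← add_smul, neg_mul, mul_comm, add_neg_cancel, zero_smul]
  have h2 := hg.eq_zero_of_smul_add_smul hZ ht htr hts htu hrs hru h1
  rw [h2, zero_smul] at hm
  exact hus (hg.cell_eq_of_gradient_eq hZ (interior_subset ht) htu hts (sub_eq_zero.1 hm))

/-- A cell which meets a slab is a slab: a boundary hyperplane of the slab is covered by the other
cells, and these are pairwise disjoint there, so that one cell contains the hyperplane. -/
theorem isSlab_of_meets [FiniteDimensional ℝ V] [Finite R]
    (hg : Represents T Z g c) (hZ : IsCellSystem T Z) {r s : R} {a : V} (hs : IsSlab a (Z s))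
    (h : (Z s ∩ Z r).Nonempty) : IsSlab a (Z r) := by
  by_cases hne : Z r = Z s
  · rwa [hne]
  obtain ⟨t, hts, htr⟩ := h
  refine isSlab_of_hyperplane_subset (t := t) (hZ.convex r) (hZ.isClosed r) ?_
  by_contra! hcon
  obtain ⟨v₀, hv₀, hv₀r⟩ := hcon
  have hcov : ∀ v, ⟪a, v⟫_ℝ = 0 → ∃ u, Z u ≠ Z s ∧ t + v ∈ Z u := by
    refine fun v hv => hZ.exists_ne_of_notMem_interior fun hmem => ?_
    have h1 := hg.lt_of_meets hZ hne ⟨t, htr, hts⟩ hmem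
    have h2 := hg.eq_of_mem_inter hZ htr hts
    have h3 := hg.inner_gradient_sub_eq_zero hZ hs ⟨t, htr, hts⟩ hv
    rw [inner_sub_left] at h3
    rw [← one_smul ℝ v, affScore_add_smul, affScore_add_smul, h2] at h1
    linarith
  have hconn : IsPreconnected ((fun v => t + v) '' ((ℝ ∙ a)ᗮ : Set V)) :=
    ((Submodule.convex _).isPreconnected).image _ (by fun_prop)
  obtain ⟨y, hy, i, j, hi, hj, hyi, hyj⟩ := exists_mem_inter_of_isPreconnected hconn
    (D := fun u : {u // Z u ≠ Z s} => Z u) (fun u => hZ.isClosed u)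
    (by
      rintro _ ⟨v, hv, rfl⟩
      obtain ⟨u, hu, huv⟩ := hcov v (Submodule.mem_orthogonal_singleton_iff_inner_right.1 hv)
      exact ⟨⟨u, hu⟩, huv⟩)
    (fun u => Z u = Z r)
    ⟨t, ⟨0, zero_mem _, add_zero t⟩, ⟨r, hne⟩, rfl, htr⟩
    (by
      obtain ⟨u, hu, huv⟩ := hcov v₀ hv₀
      exact ⟨t + v₀, ⟨v₀, Submodule.mem_orthogonal_singleton_iff_inner_right.2 hv₀, rfl⟩, ⟨u, hu⟩,
        fun h => hv₀r (h ▸ huv), huv⟩)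
  obtain ⟨v, hv, rfl⟩ := hy
  have hys := hs t hts v (Submodule.mem_orthogonal_singleton_iff_inner_right.1 hv)
  exact hg.not_nonempty_triple_of_isSlab hZ hs i.2 j.2 (fun h => hj (h ▸ hi))
    ⟨_, ⟨hyi, hys⟩, hyj⟩

/-- A cell is a slab if the scores of all adjacent cells differ from its own one by functions of
`⟪a, ·⟫` only. -/
theorem isSlab_of_forall_adjacent [Finite R]
    (hg : Represents T Z g c) (hZ : IsCellSystem T Z) {s : R} {a : V}
    (h : ∀ r, Z r ≠ Z s → (Z r ∩ Z s).Nonempty → ∀ v, ⟪a, v⟫_ℝ = 0 → ⟪g r - g s, v⟫_ℝ = 0) :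
    IsSlab a (Z s) := by
  intro x hx v hv
  have hint : ∀ y ∈ interior (Z s), y + v ∈ Z s := by
    intro y hy
    by_contra hyv
    obtain ⟨u, hu⟩ := hZ.cover (y + v)
    -- otherwise the segment from `y` to `y + v` leaves the cell through an adjacent cell
    obtain ⟨z, ⟨τ, -, rfl⟩, i, j, hi, hj, hzi, hzj⟩ := exists_mem_inter_of_isPreconnected
      ((convex_Icc (0 : ℝ) 1).isPreconnected.image (fun τ => y + τ • v) (by fun_prop))
      hZ.isClosed (fun x _ => hZ.cover x) (fun u => Z u = Z s)
      ⟨y, ⟨0, by simp, by simp⟩, s, rfl, interior_subset hy⟩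
      ⟨y + v, ⟨1, by simp, by simp⟩, u, fun h => hyv (h ▸ hu), hu⟩
    replace hzi := hi ▸ hzi
    have h1 := h j hj ⟨_, hzj, hzi⟩ v hv
    have h2 := hg.eq_of_mem_inter hZ hzj hzi
    have h3 := hg.lt_of_meets hZ hj ⟨_, hzj, hzi⟩ hy
    rw [inner_sub_left, sub_eq_zero] at h1
    rw [affScore_add_smul, affScore_add_smul, h1] at h2
    linarith
  have hmaps := Set.MapsTo.closure (f := fun y => y + v) hint (by fun_prop)
  rw [(hZ.isClosed s).closure_eq] at hmaps
  exact hmaps (hZ.mem_closure_interior hx)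

/-! ### The common factor of proportionality -/

/-- Let the cells adjacent to `Z s` fall into two classes such that no cells from different classes
meet on `Z s`, and let `Z r` and `Z u` be in different classes. Then the halfspaces in which the
score of `r` or of `u` is at least that of `s` are disjoint: otherwise their union is connected and
avoids the interior of `Z s`, and its radial projection is a connected subset of the boundary of
`Z s` meeting both classes. -/
theorem disjoint_halfspaces [Finite R] (hg : Represents T Z g c) (hZ : IsCellSystem T Z) {s r u : R}
    (P : R → Prop)
    (hP : ∀ i j, Z i ≠ Z s → Z j ≠ Z s → P i → ¬ P j → ¬ (Z i ∩ Z s ∩ Z j).Nonempty)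
    (hrs : Z r ≠ Z s) (hus : Z u ≠ Z s) (hr : (Z r ∩ Z s).Nonempty) (hu : (Z u ∩ Z s).Nonempty)
    (hPr : P r) (hPu : ¬ P u) {z : V} (hzr : affScore g c s z ≤ affScore g c r z) :
    ¬ affScore g c s z ≤ affScore g c u z := by
  intro hzu
  set H : R → Set V := fun i => {y | affScore g c s y ≤ affScore g c i y} with hH
  have hHconv : ∀ i, Convex ℝ (H i) := by
    intro i
    have : H i = {y | ⟪g s - g i, y⟫_ℝ ≤ c i - c s} := by
      ext y
      simp only [hH, affScore, Set.mem_ofPred_eq, inner_sub_left]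
      constructor <;> intro h <;> linarith
    rw [this]
    exact convex_halfSpace_le (innerₛₗ ℝ (g s - g i)).isLinear _
  have hconn : IsPreconnected (H r ∪ H u) :=
    IsPreconnected.union z hzr hzu (hHconv r).isPreconnected (hHconv u).isPreconnected
  obtain ⟨o, ho, -⟩ := hZ.interior_nonempty s
  -- the cell is translated such that the centre of the radial projection is `0`
  set K : Set V := (fun y => o + y) ⁻¹' Z s with hK
  have hKconv : Convex ℝ K := (hZ.convex s).translate_preimage_right o
  have hKclosed : IsClosed K := (hZ.isClosed s).preimage (by fun_prop)
  have hint : ∀ y, o + y ∈ interior (Z s) → y ∈ interior K := by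
    intro y hy
    exact preimage_interior_subset_interior_preimage (f := fun y => o + y) (by fun_prop) hy
  have hint' : ∀ y, y ∈ interior K → o + y ∈ interior (Z s) := by
    intro y hy
    have := (Homeomorph.addLeft o).preimage_interior (Z s)
    exact (Set.ext_iff.1 this y).2 hy
  have hK0 : K ∈ 𝓝 (0 : V) :=
    mem_interior_iff_mem_nhds.1 (hint 0 (by rwa [add_zero]))
  have hgauge : ∀ y ∈ H r ∪ H u, 1 ≤ gauge K (y - o) := by
    intro y hy
    by_contra! hlt
    have hy' : y ∈ interior (Z s) := by
      simpa using hint' _ ((gauge_lt_one_iff_mem_interior hKconv hK0).1 hlt)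
    rcases hy with hy | hy
    · exact absurd (hg.lt_of_meets hZ hrs hr hy') (not_lt.2 hy)
    · exact absurd (hg.lt_of_meets hZ hus hu hy') (not_lt.2 hy)
  set ρ : V → V := fun y => o + (gauge K (y - o))⁻¹ • (y - o) with hρ
  have hρc : ContinuousOn ρ (H r ∪ H u) := by
    have h1 : Continuous fun y => gauge K (y - o) :=
      (continuous_gauge hKconv hK0).comp (by fun_prop)
    exact continuousOn_const.add ((h1.continuousOn.inv₀ fun y hy =>
      (zero_lt_one.trans_le (hgauge y hy)).ne').smul (by fun_prop))
  have hfix : ∀ i, Z i ≠ Z s → H i ⊆ H r ∪ H u → ∀ y, y ∈ Z i → y ∈ Z s → ρ y = y := by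
    intro i hi hsub y hyi hys
    have h1 := hgauge y (hsub (hg.le_of_meets hZ ⟨y, hys, hyi⟩ hyi))
    have h2 : gauge K (y - o) ≤ 1 := gauge_le_one_of_mem (by simpa [hK] using hys)
    simp [hρ, le_antisymm h2 h1]
  obtain ⟨xr, hxr, hxrs⟩ := hr
  obtain ⟨xu, hxu, hxus⟩ := hu
  obtain ⟨y, -, i, j, hi, hj, ⟨hyi, hys⟩, ⟨hyj, -⟩⟩ := exists_mem_inter_of_isPreconnected
    (hconn.image ρ hρc) (D := fun i : {i // Z i ≠ Z s} => Z i ∩ Z s)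
    (fun i => (hZ.isClosed i).inter (hZ.isClosed s))
    (by
      rintro _ ⟨y, hy, rfl⟩
      have hpos := zero_lt_one.trans_le (hgauge y hy)
      have h1 : gauge K ((gauge K (y - o))⁻¹ • (y - o)) = 1 := by
        rw [gauge_smul_of_nonneg (inv_nonneg.2 hpos.le), smul_eq_mul, inv_mul_cancel₀ hpos.ne']
      have h2 : (gauge K (y - o))⁻¹ • (y - o) ∈ K := by
        have h3 := (gauge_le_one_iff_mem_closure hKconv hK0).1 h1.le
        rwa [hKclosed.closure_eq] at h3
      obtain ⟨i, hi, hyi⟩ := hZ.exists_ne_of_notMem_interior (s := s) (x := ρ y) fun h =>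
        ((gauge_lt_one_iff_mem_interior hKconv hK0).2 (hint _ h)).ne h1
      exact ⟨⟨i, hi⟩, hyi, h2⟩)
    (fun i => P i)
    ⟨xr, ⟨xr, Or.inl (hg.le_of_meets hZ ⟨xr, hxrs, hxr⟩ hxr),
      hfix r hrs Set.subset_union_left xr hxr hxrs⟩, ⟨r, hrs⟩, hPr, hxr, hxrs⟩
    ⟨xu, ⟨xu, Or.inr (hg.le_of_meets hZ ⟨xu, hxus, hxu⟩ hxu),
      hfix u hus Set.subset_union_right xu hxu hxus⟩, ⟨u, hus⟩, hPu, hxu, hxus⟩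
  exact hP i j i.2 j.2 hi hj ⟨y, ⟨hyi, hys⟩, hyj⟩

/-- The factor of proportionality is the same for all cells adjacent to a given one. Otherwise the
adjacent cells fall into two classes which do not meet, all bounding hyperplanes of the cell are
parallel, the cell and therefore all cells are parallel slabs, and no three of them meet. -/
theorem smul_eq_of_adjacent [FiniteDimensional ℝ V] [Finite R]
    (hg : Represents T Z g c) (hg' : Represents T Z g' c') (hZ : IsCellSystem T Z)
    (hpar : ∀ r s u, Z r ≠ Z s → Z u ≠ Z s → Z r ≠ Z u →
      ∃ r s u, Z r ≠ Z s ∧ Z u ≠ Z s ∧ Z r ≠ Z u ∧ (Z r ∩ Z s ∩ Z u).Nonempty)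
    {r s u : R} (hrs : Z r ≠ Z s) (hus : Z u ≠ Z s) (hr : (Z r ∩ Z s).Nonempty)
    (hu : (Z u ∩ Z s).Nonempty) {l : ℝ} (hl : g' r - g' s = l • (g r - g s)) :
    g' u - g' s = l • (g u - g s) := by
  by_contra hlu
  set P : R → Prop := fun i => g' i - g' s = l • (g i - g s) with hPdef
  have hP : ∀ i j, Z i ≠ Z s → Z j ≠ Z s → P i → ¬ P j → ¬ (Z i ∩ Z s ∩ Z j).Nonempty :=
    fun i j hi hj hPi hPj h => hPj (hg.smul_eq_of_triple hg' hZ hi hj h hPi)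
  have hperp : ∀ i j, Z i ≠ Z s → Z j ≠ Z s → (Z i ∩ Z s).Nonempty → (Z j ∩ Z s).Nonempty →
      P i → ¬ P j → ∀ v, ⟪g i - g s, v⟫_ℝ = 0 ↔ ⟪g j - g s, v⟫_ℝ = 0 := by
    intro i j hi hj hin hjn hPi hPj v
    have hne : ∀ k, Z k ≠ Z s → (Z k ∩ Z s).Nonempty → g k - g s ≠ 0 := by
      intro k hk hkn h
      obtain ⟨t, ht, htk, hts⟩ := hZ.meets₂ hkn
      exact hk (hg.cell_eq_of_gradient_eq hZ (interior_subset ht) htk hts (sub_eq_zero.1 h))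
    refine inner_eq_zero_of_disjoint_halfspaces (α := c i - c s) (β := c j - c s)
      (hne i hi hin) (hne j hj hjn) fun z h1 h2 => ?_
    rw [inner_sub_left] at h1 h2
    refine hg.disjoint_halfspaces hZ P hP hi hj hin hjn hPi hPj (z := z) ?_ ?_
    · rw [affScore, affScore]
      linarith
    · rw [affScore, affScore]
      linarith
  have hslab : IsSlab (g r - g s) (Z s) := by
    refine hg.isSlab_of_forall_adjacent hZ fun i hi hin v hv => ?_
    by_cases hPi : P i
    · exact (hperp i u hi hus hin hu hPi hlu v).2 ((hperp r u hrs hus hr hu hl hlu v).1 hv)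
    · exact (hperp r i hrs hi hr hin hl hPi v).1 hv
  have hall : ∀ i, IsSlab (g r - g s) (Z i) :=
    hZ.induction_on_meets hslab fun i j hij hi => hg.isSlab_of_meets hZ hi hij
  have hru : Z r ≠ Z u := fun h => hlu (by
    rwa [← (hg.eq_of_cell_eq hZ h).1, ← (hg'.eq_of_cell_eq hZ h).1])
  obtain ⟨i, j, k, hij, hkj, hik, hne⟩ := hpar r s u hrs hus hru
  exact hg.not_nonempty_triple_of_isSlab hZ (hall j) hij hkj hik hne

/-- Two scores with the same cells are related by a positive factor and a common affine function. -/
theorem exists_eq_smul_add [FiniteDimensional ℝ V] [Finite R]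
    (hg : Represents T Z g c) (hg' : Represents T Z g' c') (hZ : IsCellSystem T Z)
    (hpar : ∀ r s u, Z r ≠ Z s → Z u ≠ Z s → Z r ≠ Z u →
      ∃ r s u, Z r ≠ Z s ∧ Z u ≠ Z s ∧ Z r ≠ Z u ∧ (Z r ∩ Z s ∩ Z u).Nonempty) :
    ∃ (l : ℝ) (p₀ : V) (k : ℝ), 0 < l ∧ (∀ r, g' r = l • g r + p₀) ∧ ∀ r, c' r = l * c r + k := by
  obtain ⟨l, hl, hadj⟩ : ∃ l : ℝ, 0 < l ∧ ∀ r s, Z r ≠ Z s → (Z r ∩ Z s).Nonempty →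
      g' r - g' s = l • (g r - g s) := by
    by_cases hex : ∃ r s, Z r ≠ Z s ∧ (Z r ∩ Z s).Nonempty
    · obtain ⟨r₀, s₀, hne, hn⟩ := hex
      obtain ⟨l, hl, h0⟩ := hg.exists_pos_smul_eq hg' hZ hne hn
      refine ⟨l, hl, fun r s => ?_⟩
      revert r
      refine hZ.induction_on_meets (P := fun s => ∀ r, Z r ≠ Z s → (Z r ∩ Z s).Nonempty →
        g' r - g' s = l • (g r - g s)) (s := s₀)
        (fun r hr hrn => hg.smul_eq_of_adjacent hg' hZ hpar hne hr hn hrn h0) ?_ s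
      intro i j hij hi r hr hrn
      by_cases heq : Z i = Z j
      · rw [← (hg.eq_of_cell_eq hZ heq).1, ← (hg'.eq_of_cell_eq hZ heq).1]
        exact hi r (heq ▸ hr) (heq ▸ hrn)
      · have h1 := hi j (Ne.symm heq) (by rwa [Set.inter_comm])
        have h2 : g' i - g' j = l • (g i - g j) := by
          rw [← neg_sub, h1, ← smul_neg, neg_sub]
        exact hg.smul_eq_of_adjacent hg' hZ hpar heq hr hij hrn h2
    · push Not at hex
      exact ⟨1, one_pos, fun r s hne hn =>
        absurd hn (Set.not_nonempty_iff_eq_empty.2 (hex r s hne))⟩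
  obtain ⟨s, -⟩ := hZ.cover 0
  have hdiff : ∀ r, g' r - l • g r = g' s - l • g s ∧ c' r - l * c r = c' s - l * c s := by
    refine hZ.induction_on_meets (s := s) ⟨rfl, rfl⟩ ?_
    rintro i j hij ⟨h1, h2⟩
    rw [← h1, ← h2]
    by_cases heq : Z j = Z i
    · rw [(hg.eq_of_cell_eq hZ heq).1, (hg.eq_of_cell_eq hZ heq).2, (hg'.eq_of_cell_eq hZ heq).1,
        (hg'.eq_of_cell_eq hZ heq).2]
      exact ⟨rfl, rfl⟩
    have hji : (Z j ∩ Z i).Nonempty := by rwa [Set.inter_comm]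
    have h3 := hadj j i heq hji
    refine ⟨?_, ?_⟩
    · rw [smul_sub] at h3
      rw [← sub_eq_zero] at h3 ⊢
      rw [← h3]
      abel
    · obtain ⟨t, ht, hti, htj⟩ := hZ.meets₂ hij
      have h4 := hg.eq_of_mem_inter hZ htj hti
      have h5 := hg'.eq_of_mem_inter hZ htj hti
      have h6 : ⟪g' j, t⟫_ℝ - ⟪g' i, t⟫_ℝ = l * (⟪g j, t⟫_ℝ - ⟪g i, t⟫_ℝ) := by
        rw [← inner_sub_left, ← inner_sub_left, h3, real_inner_smul_left]
      simp only [affScore] at h4 h5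
      linear_combination h5 - h6 - l * h4
  refine ⟨l, g' s - l • g s, c' s - l * c s, hl, fun r => ?_, fun r => ?_⟩
  · rw [← (hdiff r).1]
    abel
  · rw [← (hdiff r).2]
    ring

end Represents

/-! ### The cells of a simple complex -/

theorem IsPolyhedron.convex {S : Set V} (h : IsPolyhedron S) : Convex ℝ S := by
  obtain ⟨H, -, rfl⟩ := h
  have : {x | ∀ h ∈ H, ⟪h.1, x⟫_ℝ ≤ h.2} = ⋂ h ∈ H, {x | ⟪h.1, x⟫_ℝ ≤ h.2} := by
    ext
    simp
  rw [this]
  exact convex_iInter₂ fun h _ => convex_halfSpace_le (innerₛₗ ℝ h.1).isLinear _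

theorem IsPolyhedron.isClosed {S : Set V} (h : IsPolyhedron S) : IsClosed S := by
  obtain ⟨H, -, rfl⟩ := h
  have : {x | ∀ h ∈ H, ⟪h.1, x⟫_ℝ ≤ h.2} = ⋂ h ∈ H, {x | ⟪h.1, x⟫_ℝ ≤ h.2} := by
    ext
    simp
  rw [this]
  exact isClosed_biInter fun h _ => isClosed_le (by fun_prop) continuous_const

theorem IsCellComplex.sInter_mem {C : Set (Set V)} (hC : IsCellComplex C) {t : V}
    {S : Set (Set V)} (hS : S.Finite) (hne : S.Nonempty) (hSC : ∀ Y ∈ S, Y ∈ C)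
    (ht : ∀ Y ∈ S, t ∈ Y) : ⋂₀ S ∈ C := by
  induction S, hS using Set.Finite.induction_on with
  | empty => exact absurd hne Set.not_nonempty_empty
  | @insert Y S _ _ ih =>
    rw [Set.sInter_insert]
    rcases S.eq_empty_or_nonempty with rfl | hne'
    · simpa using hSC Y (Set.mem_insert _ _)
    · refine hC.inter _ (hSC Y (Set.mem_insert _ _)) _
        (ih hne' (fun X hX => hSC X (Set.mem_insert_of_mem _ hX))
          (fun X hX => ht X (Set.mem_insert_of_mem _ hX)))
        ⟨t, ht Y (Set.mem_insert _ _), fun X hX => ht X (Set.mem_insert_of_mem _ hX)⟩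

theorem IsSimpleComplex.isCellSystem [FiniteDimensional ℝ V] [Finite R] {C : Set (Set V)}
    (hC : IsSimpleComplex C) (hmeet : ∀ F ∈ C, (F ∩ interior T).Nonempty)
    (hrange : Set.range Z = cells C) : IsCellSystem T Z := by
  obtain ⟨hC, hcount⟩ := hC
  have hcell : ∀ r, Z r ∈ cells C := fun r => hrange ▸ Set.mem_range_self r
  have hmem : ∀ r, Z r ∈ C := fun r => (hcell r).1
  have hconv : ∀ r, Convex ℝ (Z r) := fun r => (hC.polyhedron _ (hmem r)).convex
  have hint : ∀ r, (interior (Z r)).Nonempty := by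
    intro r
    rw [(hconv r).interior_nonempty_iff_affineSpan_eq_top,
      AffineSubspace.affineSpan_eq_top_iff_vectorSpan_eq_top_of_nonempty ℝ V V
        (hC.nonempty _ (hmem r))]
    exact Submodule.eq_top_of_finrank_eq (hcell r).2
  have hcov : ∀ x, ∃ r, x ∈ Z r := by
    intro x
    obtain ⟨F, hF, hxF⟩ : x ∈ ⋃₀ C := hC.cover ▸ Set.mem_univ x
    -- by simplicity, every face is contained in a cell
    have h1 := hcount F hF
    have h2 : dim F ≤ Module.finrank ℝ V := Submodule.finrank_le _
    obtain ⟨Y, hY, hFY⟩ := Set.nonempty_of_ncard_ne_zero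
      (s := {Z | Z ∈ cells C ∧ F ⊆ Z}) (by omega)
    obtain ⟨r, rfl⟩ : Y ∈ Set.range Z := hrange ▸ hY
    exact ⟨r, hFY hxF⟩
  refine ⟨hconv, fun r => (hC.polyhedron _ (hmem r)).isClosed, ?_, hcov, ?_, ?_, ?_⟩
  · intro r
    obtain ⟨x, hxZ, hxT⟩ := hmeet _ (hmem r)
    have hx : x ∈ closure (interior (Z r)) := by
      rw [(hconv r).closure_interior_eq_closure_of_nonempty_interior (hint r)]
      exact subset_closure hxZ
    rw [Set.inter_comm]
    exact mem_closure_iff.1 hx _ isOpen_interior hxT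
  · intro r s hne
    exact (hC.disjoint (hmem r) (hmem s) hne).mono interior_subset_intrinsicInterior
      interior_subset_intrinsicInterior
  · intro r s u h
    exact hmeet _ (hC.inter _ (hC.inter _ (hmem r) _ (hmem s) (h.mono Set.inter_subset_left)) _
      (hmem u) h)
  · intro t _
    have hG : ⋂ r ∈ {r | t ∈ Z r}, Z r = ⋂₀ (Z '' {r | t ∈ Z r}) := by rw [Set.sInter_image]
    obtain ⟨r₀, hr₀⟩ := hcov t
    have hGC : ⋂ r ∈ {r | t ∈ Z r}, Z r ∈ C := by
      rw [hG]
      refine hC.sInter_mem (t := t) (Set.toFinite _) ⟨_, r₀, hr₀, rfl⟩ ?_ ?_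
      · rintro _ ⟨r, -, rfl⟩
        exact hmem r
      · rintro _ ⟨r, hr, rfl⟩
        exact hr
    rw [← hcount _ hGC]
    congr 2
    ext Y
    constructor
    · rintro ⟨r, hr, rfl⟩
      exact ⟨hcell r, Set.biInter_subset_of_mem hr⟩
    · rintro ⟨hY, hsub⟩
      obtain ⟨r, rfl⟩ : Y ∈ Set.range Z := hrange ▸ hY
      exact ⟨r, hsub (Set.mem_iInter₂.2 fun r hr => hr), rfl⟩

theorem IsCellSystem.eq_of_inter_eq (hZ : IsCellSystem T Z) {r s : R} (h : Z r ∩ T = Z s ∩ T) :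
    Z r = Z s := by
  by_contra hne
  obtain ⟨x, hxr, hxT⟩ := hZ.interior_nonempty r
  refine Set.disjoint_left.1 (hZ.disjoint r s hne) hxr (mem_interior_iff_mem_nhds.2 ?_)
  filter_upwards [mem_interior_iff_mem_nhds.1 hxr, mem_interior_iff_mem_nhds.1 hxT] with y hy hyT
  exact (h ▸ (⟨hy, hyT⟩ : y ∈ Z r ∩ T) : y ∈ Z s ∩ T).1

/-! ### Affine scores with extended real values -/

/-- A regular affine score of a property whose level sets have interior points is real-valued, as
the infinite part vanishes on the level sets. -/
theorem IsAffineScore.exists_eq_affScore [FiniteDimensional ℝ V] {Γ : Property T R}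
    (hZ : IsCellSystem T Z) (hlevel : ∀ r, Γ.levelSet r = Z r ∩ T) {A : R → V → EReal}
    (hA : IsAffineScore Γ A) :
    ∃ (g : R → V) (c : R → ℝ), ∀ r t, A r t = (affScore g c r t : EReal) := by
  have key : ∀ r, ∃ (a : V) (b : ℝ), ∀ t, A r t = ((⟪a, t⟫_ℝ + b : ℝ) : EReal) := by
    intro r
    obtain ⟨f, h, hfh⟩ := hA.affine r
    have hzero : ∀ t ∈ Z r ∩ T, h t = 0 := by
      intro t ht
      obtain ⟨htT, hrt⟩ : t ∈ Γ.levelSet r := hlevel r ▸ ht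
      have h1 := (hA.lt_top r ⟨t, htT⟩).ne
      have h2 := hA.finite ⟨t, htT⟩ r hrt
      rw [hfh] at h1 h2
      rcases lt_trichotomy (h t) 0 with hlt | heq | hgt
      · rw [EReal.top_mul_coe_of_neg hlt, EReal.add_bot] at h2
        exact absurd rfl h2
      · exact heq
      · rw [EReal.top_mul_coe_of_pos hgt, EReal.coe_add_top] at h1
        exact absurd rfl h1
    obtain ⟨x, hxr, hxT⟩ := hZ.interior_nonempty r
    have hlin : ∀ v, h.linear v = 0 := by
      intro v
      obtain ⟨ε, hε, hmem⟩ := exists_pos_forall_add_smul_mem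
        (Filter.inter_mem (mem_interior_iff_mem_nhds.1 hxr) (mem_interior_iff_mem_nhds.1 hxT)) v
      have h1 := hzero _ (hmem ε (abs_of_pos hε).le)
      rw [add_comm, ← vadd_eq_add, AffineMap.map_vadd,
        hzero x ⟨interior_subset hxr, interior_subset hxT⟩, map_smul, vadd_eq_add, add_zero,
        smul_eq_mul] at h1
      exact (mul_eq_zero.1 h1).resolve_left hε.ne'
    have hh : ∀ t, h t = 0 := by
      intro t
      have h1 := h.map_vadd x (t - x)
      rw [hlin, hzero x ⟨interior_subset hxr, interior_subset hxT⟩, vadd_eq_add, vadd_eq_add,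
        sub_add_cancel, add_zero] at h1
      exact h1
    refine ⟨(InnerProductSpace.toDual ℝ V).symm (LinearMap.toContinuousLinearMap f.linear), f 0,
      fun t => ?_⟩
    have h1 := f.map_vadd 0 t
    rw [vadd_eq_add, vadd_eq_add, add_zero] at h1
    rw [hfh, hh, EReal.coe_zero, mul_zero, add_zero, InnerProductSpace.toDual_symm_apply, h1]
    rfl
  choose a b hab using key
  exact ⟨a, b, hab⟩

theorem elicits_iff_represents {Γ : Property T R} (hlevel : ∀ r, Γ.levelSet r = Z r ∩ T)
    {A : R → V → EReal} (hA : ∀ r t, A r t = (affScore g c r t : EReal)) :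
    Elicits A Γ ↔ Represents T Z g c := by
  have hmem : ∀ (t : V) (ht : t ∈ T) (r : R), r ∈ Γ.correct ⟨t, ht⟩ ↔ t ∈ Z r := by
    intro t ht r
    have h := Set.ext_iff.1 (hlevel r) t
    exact ⟨fun hr => (h.1 ⟨ht, hr⟩).1, fun hr => (h.2 ⟨hr, ht⟩).2⟩
  constructor
  · intro h t ht r
    rw [← hmem t ht r, h ⟨t, ht⟩]
    simp [hA]
  · rintro h ⟨t, ht⟩
    ext r
    rw [hmem t ht r, h t ht r]
    simp [hA]

theorem Property.NotParallel.exists_triple [Finite R] {Γ : Property T R} (hpar : Γ.NotParallel)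
    (hZ : IsCellSystem T Z) (hlevel : ∀ r, Γ.levelSet r = Z r ∩ T) {r s u : R} (hrs : Z r ≠ Z s)
    (hus : Z u ≠ Z s) (hru : Z r ≠ Z u) :
    ∃ r s u, Z r ≠ Z s ∧ Z u ≠ Z s ∧ Z r ≠ Z u ∧ (Z r ∩ Z s ∩ Z u).Nonempty := by
  have hinj : ∀ {i j}, Z i ≠ Z j → Γ.levelSet i ≠ Γ.levelSet j := fun hne h =>
    hne (hZ.eq_of_inter_eq (by rw [← hlevel, ← hlevel, h]))
  obtain ⟨⟨t, ht⟩, h3⟩ := hpar ((Set.two_lt_ncard_iff (Set.toFinite _)).2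
    ⟨_, _, _, ⟨r, rfl⟩, ⟨s, rfl⟩, ⟨u, rfl⟩, hinj hrs, hinj hru, hinj hus.symm⟩)
  obtain ⟨_, _, _, ⟨i, hi, rfl⟩, ⟨j, hj, rfl⟩, ⟨k, hk, rfl⟩, hij, hik, hjk⟩ :=
    (Set.two_lt_ncard_iff (Set.toFinite _)).1 h3
  have hne : ∀ {i j}, Γ.levelSet i ≠ Γ.levelSet j → Z i ≠ Z j := fun h h' =>
    h (by rw [hlevel, hlevel, h'])
  have hmem : ∀ i ∈ Γ.correct ⟨t, ht⟩, t ∈ Z i := fun i hi =>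
    (hlevel i ▸ (⟨ht, hi⟩ : t ∈ Γ.levelSet i) : t ∈ Z i ∩ T).1
  exact ⟨i, j, k, hne hij, (hne hjk).symm, hne hik, t, ⟨hmem i hi, hmem j hj⟩, hmem k hk⟩

/-! ### Power diagrams -/

theorem powerScore_eq_affScore (q : R → V) (w : R → ℝ) (r : R) (t : V) :
    powerScore q w r t = affScore (fun r => (2 : ℝ) • q r) (fun r => w r - ‖q r‖ ^ 2) r t := by
  rw [powerScore, affScore, real_inner_smul_left]
  ring

theorem forall_eq_powerCell_iff_represents {Γ : Property T R}
    (hlevel : ∀ r, Γ.levelSet r = Z r ∩ T) {q : R → V} {v : R → ℝ} :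
    (∀ r, Γ.levelSet r = powerCell T q v r) ↔
      Represents T Z (fun r => (2 : ℝ) • q r) (fun r => v r - ‖q r‖ ^ 2) := by
  have hpow : ∀ t r r', ‖q r - t‖ ^ 2 - v r ≤ ‖q r' - t‖ ^ 2 - v r' ↔
      affScore (fun r => (2 : ℝ) • q r) (fun r => v r - ‖q r‖ ^ 2) r' t ≤
        affScore (fun r => (2 : ℝ) • q r) (fun r => v r - ‖q r‖ ^ 2) r t := by
    intro t r r'
    rw [norm_sub_sq_real, norm_sub_sq_real, affScore, affScore, real_inner_smul_left,
      real_inner_smul_left]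
    constructor <;> intro h <;> linarith
  simp only [hlevel, Set.ext_iff, powerCell, hpow]
  constructor
  · intro h t ht r
    exact ⟨fun hr => ((h r t).1 ⟨hr, ht⟩).2, fun hr => ((h r t).2 ⟨ht, hr⟩).1⟩
  · intro h r t
    exact ⟨fun ht => ⟨ht.2, (h t ht.2 r).1 ht.1⟩, fun ht => ⟨(h t ht.1 r).2 ht.2, ht.1⟩⟩

theorem Represents.smul_add (hg : Represents T Z g c) {α : ℝ} (hα : 0 < α) (p₀ : V) (k : ℝ) :
    Represents T Z (fun r => α • g r + p₀) (fun r => α * c r + k) := by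
  intro t ht r
  rw [hg t ht r]
  have h : ∀ r, affScore (fun r => α • g r + p₀) (fun r => α * c r + k) r t =
      α * affScore g c r t + (⟪p₀, t⟫_ℝ + k) := by
    intro r
    rw [affScore, affScore, inner_add_left, real_inner_smul_left]
    ring
  simp only [h, add_le_add_iff_right, mul_le_mul_iff_right₀ hα]

/-- The constant terms are determined by the gradients, up to a common constant. -/
theorem Represents.exists_eq_add [FiniteDimensional ℝ V] [Finite R]
    (hg : Represents T Z g c) (hg' : Represents T Z g c') (hZ : IsCellSystem T Z)
    (hpar : ∀ r s u, Z r ≠ Z s → Z u ≠ Z s → Z r ≠ Z u →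
      ∃ r s u, Z r ≠ Z s ∧ Z u ≠ Z s ∧ Z r ≠ Z u ∧ (Z r ∩ Z s ∩ Z u).Nonempty) :
    ∃ k : ℝ, ∀ r, c' r = c r + k := by
  obtain ⟨l, p₀, k, -, h1, h2⟩ := hg.exists_eq_smul_add hg' hZ hpar
  by_cases hl : l = 1
  · exact ⟨k, fun r => by rw [h2, hl, one_mul]⟩
  -- if the factor is not `1`, then the gradients and hence the constant terms are all equal
  have hconst : ∀ r s, g r = g s := by
    intro r s
    have h3 : (1 - l) • (g r - g s) = 0 := by
      have hr := h1 r
      have hs := h1 s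
      rw [sub_smul, one_smul, smul_sub]
      nth_rewrite 1 [hr]
      nth_rewrite 1 [hs]
      abel
    exact sub_eq_zero.1 ((smul_eq_zero.1 h3).resolve_left (sub_ne_zero.2 (Ne.symm hl)))
  have hle : ∀ r s, c s ≤ c r := by
    intro r s
    obtain ⟨x, hxr, hxT⟩ := hZ.interior_nonempty r
    have h3 := (hg x (interior_subset hxT) r).1 (interior_subset hxr) s
    rw [affScore, affScore, hconst s r] at h3
    linarith
  obtain ⟨s, -⟩ := hZ.cover 0
  refine ⟨l * c s + k - c s, fun r => ?_⟩
  rw [h2, le_antisymm (hle s r) (hle r s)]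
  ring

end Elicitation

open Elicitation
theorem mainTheorem5 {V : Type*} [NormedAddCommGroup V] [InnerProductSpace ℝ V]
    [FiniteDimensional ℝ V] {R : Type*} [Finite R]
    (T : Set V) (hT : Convex ℝ T) (Γ : Property T R)
    (helic : Γ.Elicitable) (hsimple : Γ.IsSimple) (hpar : Γ.NotParallel) :
    ∃ (p : R → V) (W : ℝ → V → R → ℝ),
      -- the affine scores that elicit `Γ`
      (∀ A : R → V → EReal, IsAffineScore Γ A →
        (Elicits A Γ ↔
          ∃ (α : ℝ) (p₀ : V) (w : R → ℝ), 0 < α ∧ (∃ c : ℝ, ∀ r, w r = W α p₀ r + c) ∧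
            ∀ r t, A r t = ((2 * ⟪α • p r + p₀, t⟫_ℝ - ‖α • p r + p₀‖ ^ 2 + w r : ℝ) : EReal))) ∧
      -- `α` and `p₀` determine the weights, up to a common additive constant
      (∀ (α : ℝ) (p₀ : V) (w : R → ℝ), 0 < α →
        (Elicits (fun r t => (powerScore (fun r => α • p r + p₀) w r t : EReal)) Γ ↔
          ∃ c : ℝ, ∀ r, w r = W α p₀ r + c)) ∧
      -- the sites of the power diagram are unique up to homothety
      (∀ q : R → V,
        (∃ v : R → ℝ, ∀ r, Γ.levelSet r = powerCell T q v r) ↔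
          ∃ (α : ℝ) (p₀ : V), 0 < α ∧ ∀ r, q r = α • p r + p₀) := by
  obtain ⟨C, hC, hmeet, Z, hrange, hlevel⟩ := hsimple
  have hZ := hC.isCellSystem hmeet hrange
  have htriple : ∀ r s u, Z r ≠ Z s → Z u ≠ Z s → Z r ≠ Z u →
      ∃ r s u, Z r ≠ Z s ∧ Z u ≠ Z s ∧ Z r ≠ Z u ∧ (Z r ∩ Z s ∩ Z u).Nonempty :=
    fun r s u h1 h2 h3 => hpar.exists_triple hZ hlevel h1 h2 h3
  obtain ⟨A₀, hA₀, hel₀⟩ := helic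
  obtain ⟨g, c, hA₀'⟩ := hA₀.exists_eq_affScore hZ hlevel
  have hg := (elicits_iff_represents hlevel hA₀').1 hel₀
  -- the sites are half the gradients of any score, since a power score has gradients `2 • p r`
  set p : R → V := fun r => (1 / 2 : ℝ) • g r with hp
  have hpg : ∀ (α : ℝ) (p₀ : V) (r : R), (2 : ℝ) • (α • p r + p₀) = α • g r + (2 : ℝ) • p₀ := by
    intro α p₀ r
    rw [hp, smul_add, smul_smul, smul_smul]
    congr 2
    ring
  have hhalf : ∀ (α : ℝ) (p₀ : V) (r : R),
      α • p r + (1 / 2 : ℝ) • p₀ = (1 / 2 : ℝ) • (α • g r + p₀) := by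
    intro α p₀ r
    rw [hp, smul_add, smul_smul, smul_smul, mul_comm]
  -- up to a constant, the score with these sites and weights is `α` times the given score plus
  -- `2 * ⟪p₀, ·⟫`
  set W : ℝ → V → R → ℝ := fun α p₀ r => α * c r + ‖α • p r + p₀‖ ^ 2 with hW
  have hpow : ∀ {α : ℝ}, 0 < α → ∀ (p₀ : V) (w : R → ℝ),
      Represents T Z (fun r => (2 : ℝ) • (α • p r + p₀)) (fun r => w r - ‖α • p r + p₀‖ ^ 2) ↔
        ∃ k : ℝ, ∀ r, w r = W α p₀ r + k := by
    intro α hα p₀ w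
    simp only [hpg]
    constructor
    · intro h
      obtain ⟨k, hk⟩ := (hg.smul_add hα ((2 : ℝ) • p₀) 0).exists_eq_add h hZ htriple
      refine ⟨k, fun r => ?_⟩
      rw [hW]
      linear_combination hk r
    · rintro ⟨k, hk⟩
      convert! hg.smul_add hα ((2 : ℝ) • p₀) k using 2 with r
      rw [hk, hW]
      ring
  refine ⟨p, W, ?_, ?_, ?_⟩
  · intro A hA
    constructor
    · intro hel
      obtain ⟨g', c', hA'⟩ := hA.exists_eq_affScore hZ hlevel
      obtain ⟨l, p₀, k, hl, h1, h2⟩ :=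
        hg.exists_eq_smul_add ((elicits_iff_represents hlevel hA').1 hel) hZ htriple
      refine ⟨l, (1 / 2 : ℝ) • p₀, fun r => W l ((1 / 2 : ℝ) • p₀) r + k, hl, ⟨k, fun r => rfl⟩,
        fun r t => ?_⟩
      rw [hA', affScore, h1, h2, hW, EReal.coe_eq_coe_iff]
      simp only [hhalf, real_inner_smul_left]
      ring
    · rintro ⟨α, p₀, w, hα, hw, hAw⟩
      refine (elicits_iff_represents hlevel fun r t => ?_).2 ((hpow hα p₀ w).2 hw)
      rw [hAw, ← powerScore_eq_affScore, powerScore]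
  · intro α p₀ w hα
    rw [← hpow hα p₀ w]
    exact elicits_iff_represents hlevel fun r t => by rw [powerScore_eq_affScore]
  · intro q
    constructor
    · rintro ⟨v, hv⟩
      obtain ⟨l, p₀, k, hl, h1, -⟩ := hg.exists_eq_smul_add
        ((forall_eq_powerCell_iff_represents hlevel).1 hv) hZ htriple
      refine ⟨l, (1 / 2 : ℝ) • p₀, hl, fun r => ?_⟩
      rw [hhalf, ← h1, smul_smul]
      norm_num
    · rintro ⟨α, p₀, hα, hq⟩
      obtain rfl : q = fun r => α • p r + p₀ := funext hq
      exact ⟨W α p₀, (forall_eq_powerCell_iff_represents hlevel).2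
        ((hpow hα p₀ _).2 ⟨0, fun r => (add_zero _).symm⟩)⟩
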